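/- Let $(\Omega,\Sigma,\mu)$ be a $\sigma$-finite measure space, $\mathbb{F}\in\{\mathbb{R},\mathbb{C}\}$, and let $P\colon\Omega\to(0,\infty]$ be measurable. For $p\in(0,\infty)$ put $\Phi_p(t)=t^p$, and put $\Phi_\infty(t)=0$ for $0\le t\le 1$, $\Phi_\infty(t)=\infty$ for $t>1$. Put $\rho_P(f)=\int_\Omega \Phi_{P(\omega)}(|f(\omega)|)\,d\mu(\omega)$, let $L_P$ be the space of all measurable $f\colon\Omega\to\mathbb{F}$ (modulo a.e. equality) with $\rho_P(tf)<\infty$ for some $t>0$, endowed with the vector topology having the sets $u\{f\colon\rho_P(f)<\varepsilon\}$, $u,\varepsilon\in(0,\infty)$, as a neighbourhood basis of the origin, and put $\|f\|_P=\inf\{t>0\colon\rho_P(f/t)<1\}$. Let $R(P)\subseteq[0,\infty]$ be the essential range of $P$, that is, the support of the image measure of $\mu$ under $P$, and assume that $P^-:=\min R(P)>0$. An Orlicz function is a non-decreasing left-continuous function $F\colon[0,\infty)\to[0,\infty]$ with $\lim_{t\to0^+}F(t)=0$ and $\lim_{t\to\infty}F(t)>0$. Its Orlicz sequence space $\ell_F$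 consists of all $a=(a_n)_{n=1}^\infty\in\mathbb{F}^{\mathbb{N}}$ with $\sum_n F(t|a_n|)<\infty$ for some $t>0$, with the vector topology having the sets $u\{a\colon\sum_nF(|a_n|)<\varepsilon\}$, $u,\varepsilon\in(0,\infty)$, as a neighbourhood basis of the origin. For $\emptyset\ne R\subseteq(0,\infty]$ let $\mathcal{K}(R)$ be the closed convex hull in $\mathcal{C}([0,1])$ of the functions $\psi_p(t)=t^p/p$, $p\in R$ (where $\psi_\infty=0$), and let $\mathcal{O}(R)$ be the set of all Orlicz functions $F$ for which there are $c\in(0,1]$, $C\in(0,\infty)$ and $\varphi\in\mathcal{K}(R)$ with $C^{-1}\varphi(t)\le F(t)\le C\varphi(t)$ for all $t\in[0,c]$. Let $(x_n)_{n=1}^\infty$ be a sequence in $L_P$ that is pairwise disjointly supported (up to null sets) and semi-normalized, i.e., there are $a,b\in(0,\infty)$ with $a\le\|x_n\|_P\le b$ for all $n$. Then $(x_n)$ has a subsequence $\mathcal{Y}=(y_n)_{n=1}^\infty$ and there is $F\in\mathcal{O}(R(P))$ such that the coefficient space \[ \mathbb{S}[L_P,\mathcal{Y}]=\Bigl\{(a_n)_{n=1}^\infty\in\mathbb{F}^{\mathbb{N}}\colon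 \sum_{n=1}^\infty a_ny_n\in L_P\Bigr\} \] (with the pointwise a.e. sum), endowed with the topology it inherits from $L_P$ through $(a_n)\mapsto\sum_n a_ny_n$, coincides with $\ell_F$, both as a set and as a topological space. -/

import Mathlib

open MeasureTheory Filter Topology
open scoped NNReal ENNReal

noncomputable section

namespace VarLeb

/-! ### Musielak-Orlicz spaces -/

/-- An Orlicz function: a non-decreasing, left-continuous `F : [0,∞) → [0,∞]` with
`F(t) → 0` as `t → 0⁺` and `lim_{t → ∞} F(t) > 0`. -/
structure IsOrlicz (F : ℝ≥0 → ℝ≥0∞) : Prop where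
  monotone : Monotone F
  left_cont : ∀ t, ContinuousWithinAt F (Set.Iio t) t
  tendsto_zero : Tendsto F (𝓝[>] 0) (𝓝 0)
  exists_pos : ∃ t, 0 < F t

section Spaces

variable {Ω : Type*} [MeasurableSpace Ω] {𝕜 : Type*} [RCLike 𝕜]

/-- The modular `ρ_M(f) = ∫ M(ω, f(ω)) dμ(ω)` of a function `f ≥ 0`. -/
def modular (M : Ω → ℝ≥0 → ℝ≥0∞) (μ : Measure Ω) (f : Ω → ℝ≥0) : ℝ≥0∞ :=
  ∫⁻ ω, M ω (f ω) ∂μ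

/-- The space `L_M`: the measurable functions `f` with `ρ_M(t|f|) < ∞` for some `t > 0`.
Functions that agree almost everywhere are not identified in the type, but nothing below
distinguishes between them. -/
def moSpace (𝕜 : Type*) [RCLike 𝕜] (M : Ω → ℝ≥0 → ℝ≥0∞) (μ : Measure Ω) : Set (Ω → 𝕜) :=
  {f | AEStronglyMeasurable f μ ∧ ∃ t : ℝ≥0, 0 < t ∧ modular M μ (fun ω => t * ‖f ω‖₊) < ∞}

/-- The vector topology of `L_M`: a neighbourhood basis of `f` is formed by the sets
`f + u B_M(ε) = {g | ρ_M(|g - f| / u) < ε}`, `u, ε ∈ (0,∞)`. -/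
def moTopology (𝕜 : Type*) [RCLike 𝕜] (M : Ω → ℝ≥0 → ℝ≥0∞) (μ : Measure Ω) :
    TopologicalSpace (moSpace 𝕜 M μ) :=
  TopologicalSpace.mkOfNhds fun f =>
    ⨅ (u : ℝ≥0) (_ : 0 < u) (ε : ℝ≥0) (_ : 0 < ε),
      𝓟 {g | modular M μ (fun ω => ‖(g : Ω → 𝕜) ω - (f : Ω → 𝕜) ω‖₊ / u) < ε}

/-- The Luxemburg functional `inf {t ∈ (0,∞) | ρ_M(|f| / t) < 1}`. -/
def luxemburg (M : Ω → ℝ≥0 → ℝ≥0∞) (μ : Measure Ω) (f : Ω → 𝕜) : ℝ≥0∞ :=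
  ⨅ (t : ℝ≥0) (_ : 0 < t) (_ : modular M μ (fun ω => ‖f ω‖₊ / t) < 1), (t : ℝ≥0∞)

/-- The sequence `x` is pairwise disjointly supported, up to null sets. -/
def DisjointlySupported (μ : Measure Ω) (x : ℕ → Ω → 𝕜) : Prop :=
  Pairwise fun m n => ∀ᵐ ω ∂μ, x m ω = 0 ∨ x n ω = 0

/-- The sequence `x` lies in `L_M` and its norms are bounded away from `0` and `∞`. -/
def SemiNormalized (M : Ω → ℝ≥0 → ℝ≥0∞) (μ : Measure Ω) (x : ℕ → Ω → 𝕜) : Prop :=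
  (∀ n, x n ∈ moSpace 𝕜 M μ) ∧
    ∃ a b : ℝ≥0, 0 < a ∧ ∀ n, (a : ℝ≥0∞) ≤ luxemburg M μ (x n) ∧ luxemburg M μ (x n) ≤ b

/-- The pointwise sum `∑ aₙ xₙ`; when `x` is disjointly supported, at almost every point at
most one term is nonzero. -/
def combine (x : ℕ → Ω → 𝕜) (a : ℕ → 𝕜) : Ω → 𝕜 :=
  fun ω => ∑' n, a n * x n ω

/-- The coefficient space `𝕊[L_M, x] = {a | ∑ aₙ xₙ ∈ L_M}`. -/
def coeffSpace (M : Ω → ℝ≥0 → ℝ≥0∞) (μ : Measure Ω) (x : ℕ → Ω → 𝕜) : Set (ℕ → 𝕜) :=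
  {a | combine x a ∈ moSpace 𝕜 M μ}

/-- The topology that `𝕊[L_M, x]` inherits from `L_M` through `a ↦ ∑ aₙ xₙ`. -/
def coeffTopology (M : Ω → ℝ≥0 → ℝ≥0∞) (μ : Measure Ω) (x : ℕ → Ω → 𝕜) :
    TopologicalSpace (coeffSpace M μ x) :=
  (moTopology 𝕜 M μ).induced fun a => ⟨combine x a.1, a.2⟩

end Spaces

/-- The Orlicz sequence space `ℓ_F`. -/
def orliczSeqSpace (𝕜 : Type*) [RCLike 𝕜] (F : ℝ≥0 → ℝ≥0∞) : Set (ℕ → 𝕜) :=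
  moSpace 𝕜 (fun _ : ℕ => F) Measure.count

/-- The topology of `ℓ_F`. -/
def orliczSeqTopology (𝕜 : Type*) [RCLike 𝕜] (F : ℝ≥0 → ℝ≥0∞) :
    TopologicalSpace (orliczSeqSpace 𝕜 F) :=
  moTopology 𝕜 (fun _ : ℕ => F) Measure.count

/-! ### Variable exponents -/

/-- The potential function `Φ_p(t) = t ^ p` for `p < ∞`, and `Φ_∞ = ∞ χ_{(1,∞)}`. -/
def potential (p : ℝ≥0∞) (t : ℝ≥0) : ℝ≥0∞ :=
  if p = ∞ then (if t ≤ 1 then 0 else ∞) else (t : ℝ≥0∞) ^ p.toReal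

section Exponent

variable {Ω : Type*} [MeasurableSpace Ω]

/-- The function `M_P(ω, t) = Φ_{P(ω)}(t)`, from which `L_P` is built. -/
def expMO (P : Ω → ℝ≥0∞) : Ω → ℝ≥0 → ℝ≥0∞ :=
  fun ω t => potential (P ω) t

/-- The essential range `R(P)`: the support of the image measure of `μ` under `P`. -/
def essRange (P : Ω → ℝ≥0∞) (μ : Measure Ω) : Set ℝ≥0∞ :=
  (μ.map P).support

end Exponent

/-! ### Orlicz functions generated near zero by power functions -/

/-- The function `ψ_p(t) = t ^ p / p` on `[0,1]`, with `ψ_∞ = 0`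
(the value at `p = 0` is irrelevant). -/
def psi (p : ℝ≥0∞) : C(unitInterval, ℝ) where
  toFun t := if p = ∞ then 0 else (t : ℝ) ^ p.toReal / p.toReal
  continuous_toFun := by
    by_cases h : p = ∞
    · simp only [h, if_true]; exact continuous_const
    · simp only [h, if_false]
      exact (continuous_subtype_val.rpow_const
        fun _ => Or.inr ENNReal.toReal_nonneg).div_const _

/-- `𝒦(R)`: the closed convex hull of `{ψ_p | p ∈ R}` in `C([0,1])`. -/
def hullK (R : Set ℝ≥0∞) : Set C(unitInterval, ℝ) :=
  closure (convexHull ℝ (psi '' R))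

/-- `𝒪(R)`: the Orlicz functions that are equivalent, on some interval `[0,c]` with
`0 < c ≤ 1`, to a function of `𝒦(R)`. -/
def orliczClass (R : Set ℝ≥0∞) : Set (ℝ≥0 → ℝ≥0∞) :=
  {F | IsOrlicz F ∧ ∃ c : ℝ, 0 < c ∧ c ≤ 1 ∧ ∃ φ ∈ hullK R, ∃ C : ℝ≥0, 0 < C ∧
    ∀ t : unitInterval, (t : ℝ) ≤ c →
      ENNReal.ofReal (φ t) ≤ C * F (Real.toNNReal t) ∧
        F (Real.toNNReal t) ≤ C * ENNReal.ofReal (φ t)}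

end VarLeb

end

/-!
Since the supports are disjoint, `ρ_P(∑ aₙ xₙ) = ∑ Aₙ(|aₙ|)` with `Aₙ(t) = ρ_P(t xₙ)`, so that the
coefficient space is a Musielak–Orlicz sequence space. For `g = s xₙ` and `t ≤ 1` the function
`Φ_p(t g) = p Φ_p(g) ψ_p(t)` is a multiple of `ψ_p(t)`, hence on `[0,1]` the function `Aₙ(s t)` is
an integral of the `ψ_p` against a measure on `R(P)`. Semi-normalization and a suitable choice of
`s` keep the mass of this measure at most `1`, and bounded away from `0` if `R(P)` is bounded;
if `∞ ∈ R(P)`, missing mass can be put on `ψ_∞ = 0`. So, up to constants, `Aₙ(s ·)` belongs to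
`𝒦(R(P))`, which is compact. Along a subsequence it converges uniformly to some `ψ ∈ 𝒦(R(P))`
with summable errors, and `F` is the extension of `ψ` by `∞`. The lower bound on `R(P)` makes all
modulars satisfy `A(s b) ≤ s ^ r A(b)` for `s ≤ 1`, which substitutes for convexity and turns the
two-sided comparison of modulars on unit balls into equality of spaces and of topologies.
-/

namespace VarLeb

/-! ### Modulars with a lower index -/

section LowerIndex

variable {E : Type*}

/-- The functional `A` has lower index at least `r`. For `r > 0` small multiples of an element
at which `A` is finite have a small modular; this plays the role of convexity. -/
def HasLowerIndex [SMul ℝ≥0 E] (r : ℝ≥0) (A : E → ℝ≥0∞) : Prop :=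
  ∀ s : ℝ≥0, 0 < s → s ≤ 1 → ∀ b, A (s • b) ≤ (s : ℝ≥0∞) ^ (r : ℝ) * A b

/-- The unit ball of the modular `B` is bounded with respect to the modular `A`. -/
def Dominates [SMul ℝ≥0 E] (B A : E → ℝ≥0∞) : Prop :=
  ∃ k : ℝ≥0, 0 < k ∧ ∃ C : ℝ≥0, ∀ b, B b < 1 → A (k • b) ≤ C

theorem exists_rpow_mul_lt {r : ℝ≥0} (hr : 0 < r) (C : ℝ≥0) {ε : ℝ≥0} (hε : 0 < ε) :
    ∃ s : ℝ≥0, 0 < s ∧ s ≤ 1 ∧ (s : ℝ≥0∞) ^ (r : ℝ) * C < ε := by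
  have hcont : Continuous fun s : ℝ≥0 => s ^ (r : ℝ) * C :=
    (NNReal.continuous_rpow_const r.coe_nonneg).mul continuous_const
  have hlim : Tendsto (fun s : ℝ≥0 => s ^ (r : ℝ) * C) (𝓝[>] 0) (𝓝 0) :=
    (hcont.tendsto' 0 0 (by simp [hr.ne'])).mono_left nhdsWithin_le_nhds
  have hle : ∀ᶠ s : ℝ≥0 in 𝓝[>] 0, s ≤ 1 := nhdsWithin_le_nhds (ge_mem_nhds zero_lt_one)
  obtain ⟨s, hsε, hs1, hs0⟩ :=
    ((hlim.eventually_lt_const hε).and (hle.and self_mem_nhdsWithin)).exists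
  refine ⟨s, hs0, hs1, ?_⟩
  rw [← ENNReal.coe_rpow_of_nonneg _ r.coe_nonneg]
  exact_mod_cast hsε

variable [MulAction ℝ≥0 E] {r : ℝ≥0} {A B : E → ℝ≥0∞}

theorem Dominates.exists_forall_lt_one_imp_lt (h : Dominates B A) (hr : 0 < r)
    (hA : HasLowerIndex r A) {u ε : ℝ≥0} (hu : 0 < u) (hε : 0 < ε) :
    ∃ v : ℝ≥0, 0 < v ∧ ∀ b, B (v⁻¹ • b) < 1 → A (u⁻¹ • b) < ε := by
  obtain ⟨k, hk, C, hC⟩ := h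
  obtain ⟨s, hs0, hs1, hs⟩ := exists_rpow_mul_lt hr C hε
  refine ⟨s * k * u, by positivity, fun b hb => ?_⟩
  have hscale : u⁻¹ • b = s • k • (s * k * u)⁻¹ • b := by
    simp only [smul_smul]
    congr 1
    field_simp
  calc A (u⁻¹ • b) ≤ (s : ℝ≥0∞) ^ (r : ℝ) * A (k • (s * k * u)⁻¹ • b) :=
        hscale ▸ hA s hs0 hs1 _
    _ ≤ (s : ℝ≥0∞) ^ (r : ℝ) * C := by gcongr; exact hC _ hb
    _ < ε := hs

theorem Dominates.exists_smul_lt_top (h : Dominates B A) (hr : 0 < r) (hB : HasLowerIndex r B)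
    {b : E} (hb : ∃ t : ℝ≥0, 0 < t ∧ B (t • b) < ∞) : ∃ t : ℝ≥0, 0 < t ∧ A (t • b) < ∞ := by
  obtain ⟨k, hk, C, hC⟩ := h
  obtain ⟨t, ht, htb⟩ := hb
  obtain ⟨s, hs0, hs1, hs⟩ := exists_rpow_mul_lt hr (B (t • b)).toNNReal one_pos
  rw [ENNReal.coe_toNNReal htb.ne] at hs
  refine ⟨k * (s * t), by positivity, ?_⟩
  rw [mul_smul, mul_smul]
  exact (hC _ ((hB s hs0 hs1 _).trans_lt hs)).trans_lt ENNReal.coe_lt_top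

end LowerIndex

/-! ### Musielak–Orlicz spaces -/

section Musielak

variable {Ω : Type*} [MeasurableSpace Ω] {𝕜 : Type*} [RCLike 𝕜]
  {M N : Ω → ℝ≥0 → ℝ≥0∞} {μ : Measure Ω}

/-- The regularity of a Musielak–Orlicz function `M` on which the elementary theory of `L_M`
rests. -/
structure IsMusielak (M : Ω → ℝ≥0 → ℝ≥0∞) (μ : Measure Ω) : Prop where
  monotone : ∀ ω, Monotone (M ω)
  map_zero : ∀ᵐ ω ∂μ, M ω 0 = 0
  measurable : Measurable fun z : Ω × ℝ≥0 => M z.1 z.2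

theorem IsMusielak.of_countable [Countable Ω] [MeasurableSingletonClass Ω]
    (hmono : ∀ ω, Monotone (M ω)) (hzero : ∀ ω, M ω 0 = 0) : IsMusielak M μ where
  monotone := hmono
  map_zero := .of_forall hzero
  measurable := measurable_from_prod_countable_right fun ω => (hmono ω).measurable

theorem IsMusielak.aemeasurable (hM : IsMusielak M μ) {f : Ω → ℝ≥0} (hf : AEMeasurable f μ) :
    AEMeasurable (fun ω => M ω (f ω)) μ :=
  hM.measurable.comp_aemeasurable (aemeasurable_id.prodMk hf)

theorem modular_mono (hM : IsMusielak M μ) : Monotone (modular M μ) :=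
  fun _ _ h => lintegral_mono fun ω => hM.monotone ω (h ω)

theorem modular_zero (hM : IsMusielak M μ) : modular M μ 0 = 0 :=
  (lintegral_congr_ae hM.map_zero).trans lintegral_zero

theorem modular_sup_le_add (hM : IsMusielak M μ) {f : Ω → ℝ≥0} (hf : AEMeasurable f μ)
    (g : Ω → ℝ≥0) : modular M μ (f ⊔ g) ≤ modular M μ f + modular M μ g := by
  rw [modular, modular, modular, ← lintegral_add_left' (hM.aemeasurable hf)]
  refine lintegral_mono fun ω => ?_
  rw [Pi.sup_apply, (hM.monotone ω).map_sup]
  exact max_le_add_of_nonneg zero_le zero_le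

theorem modular_count [MeasurableSingletonClass Ω] (f : Ω → ℝ≥0) :
    modular M Measure.count f = ∑' ω, M ω (f ω) :=
  lintegral_count _

theorem HasLowerIndex.modular {r : ℝ≥0} (h : ∀ᵐ ω ∂μ, HasLowerIndex r (M ω)) :
    HasLowerIndex r (modular M μ) := by
  intro s hs0 hs1 f
  rw [VarLeb.modular, VarLeb.modular,
    ← lintegral_const_mul' _ _ (ENNReal.rpow_ne_top_of_nonneg r.coe_nonneg ENNReal.coe_ne_top)]
  exact lintegral_mono_ae (h.mono fun ω hω => hω s hs0 hs1 (f ω))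

/-- The basic neighbourhood `f + u B_M(ε)` of `f` in `L_M`. -/
def moBall (f : moSpace 𝕜 M μ) (u ε : ℝ≥0) : Set (moSpace 𝕜 M μ) :=
  {g | modular M μ (fun ω => ‖(g : Ω → 𝕜) ω - (f : Ω → 𝕜) ω‖₊ / u) < ε}

theorem mem_moBall_self (hM : IsMusielak M μ) (f : moSpace 𝕜 M μ) (u : ℝ≥0) {ε : ℝ≥0}
    (hε : 0 < ε) : f ∈ moBall f u ε := by
  have hzero : (fun ω => ‖(f : Ω → 𝕜) ω - (f : Ω → 𝕜) ω‖₊ / u) = 0 := by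
    ext ω; simp
  rw [moBall, Set.mem_ofPred_eq, hzero, modular_zero hM]
  exact_mod_cast hε

theorem moBall_subset_moBall (hM : IsMusielak M μ) (f : moSpace 𝕜 M μ) {u v ε δ : ℝ≥0}
    (hu : 0 < u) (huv : u ≤ v) (hεδ : ε ≤ δ) : moBall f u ε ⊆ moBall f v δ := fun _ hg =>
  (modular_mono hM fun _ => by gcongr).trans_lt (hg.trans_le (by exact_mod_cast hεδ))

theorem moBall_half_subset_moBall (hM : IsMusielak M μ) {f g : moSpace 𝕜 M μ} {u ε : ℝ≥0}
    (hg : g ∈ moBall f (u / 2) (ε / 2)) : moBall g (u / 2) (ε / 2) ⊆ moBall f u ε := by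
  intro h hh
  have hmeas : AEMeasurable (fun ω => ‖(h : Ω → 𝕜) ω - (g : Ω → 𝕜) ω‖₊ / (u / 2)) μ :=
    (h.2.1.sub g.2.1).nnnorm.aemeasurable.div_const _
  refine (modular_mono hM fun ω => ?_).trans_lt
    ((modular_sup_le_add hM hmeas _).trans_lt ((ENNReal.add_lt_add hh hg).trans_eq ?_))
  · have htri : ‖(h : Ω → 𝕜) ω - (f : Ω → 𝕜) ω‖₊ ≤
        ‖(h : Ω → 𝕜) ω - (g : Ω → 𝕜) ω‖₊ + ‖(g : Ω → 𝕜) ω - (f : Ω → 𝕜) ω‖₊ := by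
      simpa only [nndist_eq_nnnorm] using nndist_triangle ((h : Ω → 𝕜) ω) (g.1 ω) (f.1 ω)
    calc ‖(h : Ω → 𝕜) ω - (f : Ω → 𝕜) ω‖₊ / u
        ≤ max ‖(h : Ω → 𝕜) ω - (g : Ω → 𝕜) ω‖₊ ‖(g : Ω → 𝕜) ω - (f : Ω → 𝕜) ω‖₊ * 2 / u := by
          gcongr
          exact htri.trans ((add_le_add (le_max_left _ _) (le_max_right _ _)).trans_eq
            (mul_two _).symm)
      _ = _ := by
          rw [← div_div_eq_mul_div, Pi.sup_apply]
          exact Monotone.map_sup (f := fun x : ℝ≥0 => x / (u / 2))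
            (fun _ _ h => div_le_div_of_nonneg_right h zero_le) _ _
  · rw [← ENNReal.coe_add, add_halves]

theorem hasBasis_iInf_principal_moBall (hM : IsMusielak M μ) (f : moSpace 𝕜 M μ) :
    (⨅ (u : ℝ≥0) (_ : 0 < u) (ε : ℝ≥0) (_ : 0 < ε), 𝓟 (moBall f u ε)).HasBasis
      (fun p : ℝ≥0 × ℝ≥0 => 0 < p.1 ∧ 0 < p.2) fun p => moBall f p.1 p.2 := by
  have hprod : (⨅ (u : ℝ≥0) (_ : 0 < u) (ε : ℝ≥0) (_ : 0 < ε), 𝓟 (moBall f u ε)) =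
      ⨅ (p : ℝ≥0 × ℝ≥0) (_ : 0 < p.1 ∧ 0 < p.2), 𝓟 (moBall f p.1 p.2) := by
    simp only [iInf_prod, iInf_and]
    exact iInf_congr fun u => iInf_comm
  rw [hprod]
  refine hasBasis_biInf_principal' ?_ ⟨(1, 1), one_pos, one_pos⟩
  rintro ⟨u, ε⟩ ⟨hu, hε⟩ ⟨v, δ⟩ ⟨hv, hδ⟩
  have huv : 0 < min u v := lt_min hu hv
  exact ⟨(min u v, min ε δ), ⟨huv, lt_min hε hδ⟩,
    moBall_subset_moBall hM f huv (min_le_left _ _) (min_le_left _ _),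
    moBall_subset_moBall hM f huv (min_le_right _ _) (min_le_right _ _)⟩

theorem hasBasis_nhds_moTopology (hM : IsMusielak M μ) (f : moSpace 𝕜 M μ) :
    (@nhds _ (moTopology 𝕜 M μ) f).HasBasis (fun p : ℝ≥0 × ℝ≥0 => 0 < p.1 ∧ 0 < p.2)
      fun p => moBall f p.1 p.2 := by
  have hbasis := hasBasis_iInf_principal_moBall (𝕜 := 𝕜) hM
  have hnhds : @nhds _ (moTopology 𝕜 M μ) f =
      ⨅ (u : ℝ≥0) (_ : 0 < u) (ε : ℝ≥0) (_ : 0 < ε), 𝓟 (moBall f u ε) := by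
    refine TopologicalSpace.nhds_mkOfNhds_of_hasBasis hbasis ?_ ?_ f
    · exact fun f p hp => mem_moBall_self hM f p.1 hp.2
    · intro f p hp
      have hhalf : 0 < p.1 / 2 ∧ 0 < p.2 / 2 := ⟨half_pos hp.1, half_pos hp.2⟩
      filter_upwards [(hbasis f).mem_of_mem (i := (p.1 / 2, p.2 / 2)) hhalf] with g hg
      exact (hbasis g).mem_iff.2 ⟨(p.1 / 2, p.2 / 2), hhalf, moBall_half_subset_moBall hM hg⟩
  exact hnhds ▸ hbasis f

theorem moSpace_subset_of_dominates {r : ℝ≥0} (hr : 0 < r) (hN : HasLowerIndex r (modular N μ))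
    (h : Dominates (modular N μ) (modular M μ)) : moSpace 𝕜 N μ ⊆ moSpace 𝕜 M μ :=
  fun _ hf => ⟨hf.1, h.exists_smul_lt_top hr hN hf.2⟩

theorem continuous_inclusion_of_dominates (hM : IsMusielak M μ) (hN : IsMusielak N μ) {r : ℝ≥0}
    (hr : 0 < r) (hMr : HasLowerIndex r (modular M μ))
    (h : Dominates (modular N μ) (modular M μ)) (hNM : moSpace 𝕜 N μ ⊆ moSpace 𝕜 M μ) :
    Continuous[moTopology 𝕜 N μ, moTopology 𝕜 M μ] (Set.inclusion hNM) := by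
  let := moTopology 𝕜 N μ
  let := moTopology 𝕜 M μ
  refine continuous_iff_continuousAt.2 fun f =>
    ((hasBasis_nhds_moTopology hN f).tendsto_iff (hasBasis_nhds_moTopology hM _)).2 ?_
  rintro ⟨u, ε⟩ ⟨hu, hε⟩
  obtain ⟨v, hv, hvu⟩ := h.exists_forall_lt_one_imp_lt hr hMr hu hε
  refine ⟨(v, 1), ⟨hv, one_pos⟩, fun g hg => ?_⟩
  simp only [moBall, Set.mem_ofPred_eq, div_eq_inv_mul, ENNReal.coe_one] at hg ⊢
  exact hvu _ hg

theorem eq_induced_inclusion {X : Type*} {s t : Set X} (h : s = t) {τs : TopologicalSpace s}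
    {τt : TopologicalSpace t} (hst : Continuous[τs, τt] (Set.inclusion h.subset))
    (hts : Continuous[τt, τs] (Set.inclusion h.symm.subset)) :
    τs = τt.induced (Set.inclusion h.subset) := by
  subst h
  have hid : Set.inclusion (subset_refl s) = id := rfl
  rw [hid] at hst hts ⊢
  rw [induced_id]
  exact le_antisymm (continuous_id_iff_le.1 hst) (continuous_id_iff_le.1 hts)

theorem dominates_modular_count [MeasurableSingletonClass Ω] {k : ℝ≥0} (hk : 0 < k) {C : ℝ≥0}
    {δ : Ω → ℝ≥0∞} (hδ : ∑' ω, δ ω ≠ ∞)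
    (h : ∀ ω t, N ω t < 1 → M ω (k * t) ≤ C * N ω t + δ ω) :
    Dominates (modular N Measure.count) (modular M Measure.count) := by
  refine ⟨k, hk, C + (∑' ω, δ ω).toNNReal, fun b hb => ?_⟩
  rw [modular_count] at hb
  calc modular M Measure.count (k • b)
      ≤ ∑' ω, (C * N ω (b ω) + δ ω) := by
        rw [modular_count]
        exact ENNReal.tsum_le_tsum fun ω => h ω _ ((ENNReal.le_tsum ω).trans_lt hb)
    _ = C * ∑' ω, N ω (b ω) + ∑' ω, δ ω := by rw [ENNReal.tsum_add, ENNReal.tsum_mul_left]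
    _ ≤ C * 1 + ∑' ω, δ ω := by gcongr
    _ = (C + (∑' ω, δ ω).toNNReal : ℝ≥0) := by
        rw [mul_one, ENNReal.coe_add, ENNReal.coe_toNNReal hδ]

end Musielak

/-! ### Disjointly supported sequences -/

section Disjoint

variable {Ω : Type*} [MeasurableSpace Ω] {𝕜 : Type*} [RCLike 𝕜]
  {M : Ω → ℝ≥0 → ℝ≥0∞} {μ : Measure Ω} {y : ℕ → Ω → 𝕜}

theorem DisjointlySupported.ae_exists_forall_ne (hy : DisjointlySupported μ y) :
    ∀ᵐ ω ∂μ, ∃ k, ∀ n, n ≠ k → y n ω = 0 := by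
  have hpair : ∀ᵐ ω ∂μ, ∀ m n, m ≠ n → y m ω = 0 ∨ y n ω = 0 := by
    simp only [ae_all_iff, eventually_imp_distrib_left]
    exact hy
  filter_upwards [hpair] with ω hω
  by_cases h : ∃ k, y k ω ≠ 0
  · obtain ⟨k, hk⟩ := h
    exact ⟨k, fun n hn => (hω n k hn).resolve_right hk⟩
  · push Not at h
    exact ⟨0, fun n _ => h n⟩

theorem combine_eq_of_forall_ne {Ω : Type*} {y : ℕ → Ω → 𝕜} {ω : Ω} {k : ℕ}
    (hk : ∀ n, n ≠ k → y n ω = 0) (a : ℕ → 𝕜) : combine y a ω = a k * y k ω :=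
  tsum_eq_single k fun n hn => by rw [hk n hn, mul_zero]

theorem aestronglyMeasurable_combine (hy : DisjointlySupported μ y)
    (hm : ∀ n, AEStronglyMeasurable (y n) μ) (a : ℕ → 𝕜) :
    AEStronglyMeasurable (combine y a) μ := by
  refine aestronglyMeasurable_of_tendsto_ae atTop
    (f := fun n ω => ∑ i ∈ Finset.range n, a i * y i ω)
    (fun n => Finset.aestronglyMeasurable_fun_sum _ fun i _ => (hm i).const_mul _) ?_
  filter_upwards [hy.ae_exists_forall_ne] with ω ⟨k, hk⟩
  rw [combine_eq_of_forall_ne hk]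
  exact (hasSum_single k fun n hn => by rw [hk n hn, mul_zero]).tendsto_sum_nat

theorem combine_sub_ae (hy : DisjointlySupported μ y) (a b : ℕ → 𝕜) :
    ∀ᵐ ω ∂μ, combine y a ω - combine y b ω = combine y (a - b) ω := by
  filter_upwards [hy.ae_exists_forall_ne] with ω ⟨k, hk⟩
  simp only [combine_eq_of_forall_ne hk, Pi.sub_apply, sub_mul]

/-- The Musielak–Orlicz function on `ℕ` that the sequence `y` induces on its coefficients. -/
noncomputable def coeffMO (M : Ω → ℝ≥0 → ℝ≥0∞) (μ : Measure Ω) (y : ℕ → Ω → 𝕜) :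
    ℕ → ℝ≥0 → ℝ≥0∞ :=
  fun n t => modular M μ fun ω => t * ‖y n ω‖₊

theorem isMusielak_coeffMO (hM : IsMusielak M μ) (ν : Measure ℕ) :
    IsMusielak (coeffMO M μ y) ν := by
  refine .of_countable (fun n s t hst => modular_mono hM fun ω => ?_) fun n => ?_
  · dsimp only
    gcongr
  · simp only [coeffMO, zero_mul]
    exact modular_zero hM

theorem hasLowerIndex_coeffMO {r : ℝ≥0} (h : HasLowerIndex r (modular M μ)) (n : ℕ) :
    HasLowerIndex r (coeffMO M μ y n) := by
  intro s hs0 hs1 t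
  simp only [coeffMO, smul_eq_mul, mul_assoc]
  exact h s hs0 hs1 fun ω => t * ‖y n ω‖₊

theorem modular_combine (hM : IsMusielak M μ) (hy : DisjointlySupported μ y)
    (hm : ∀ n, AEStronglyMeasurable (y n) μ) (a : ℕ → 𝕜) (t : ℝ≥0) :
    modular M μ (fun ω => t * ‖combine y a ω‖₊) =
      modular (coeffMO M μ y) Measure.count fun n => t * ‖a n‖₊ := by
  rw [modular_count]
  simp only [coeffMO, modular]
  rw [← lintegral_tsum fun n => hM.aemeasurable ((hm n).nnnorm.aemeasurable.const_mul _)]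
  refine lintegral_congr_ae ?_
  filter_upwards [hy.ae_exists_forall_ne, hM.map_zero] with ω ⟨k, hk⟩ hzero
  rw [combine_eq_of_forall_ne hk, tsum_eq_single k fun n hn => by
    rw [hk n hn, nnnorm_zero, mul_zero, hzero], nnnorm_mul, mul_assoc]

theorem coeffSpace_eq_moSpace (hM : IsMusielak M μ) (hy : DisjointlySupported μ y)
    (hm : ∀ n, AEStronglyMeasurable (y n) μ) :
    coeffSpace M μ y = moSpace 𝕜 (coeffMO M μ y) Measure.count := by
  ext a
  have ha : AEStronglyMeasurable a Measure.count := .of_discrete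
  simp only [coeffSpace, moSpace, Set.mem_ofPred_eq, aestronglyMeasurable_combine hy hm a,
    modular_combine hM hy hm, ha]

theorem combine_mem_moBall_iff (hM : IsMusielak M μ) (hy : DisjointlySupported μ y)
    (hm : ∀ n, AEStronglyMeasurable (y n) μ) (a b : coeffSpace M μ y)
    (h : coeffSpace M μ y ⊆ moSpace 𝕜 (coeffMO M μ y) Measure.count) (u ε : ℝ≥0) :
    (⟨combine y b.1, b.2⟩ : moSpace 𝕜 M μ) ∈ moBall ⟨combine y a.1, a.2⟩ u ε ↔
      Set.inclusion h b ∈ moBall (Set.inclusion h a) u ε := by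
  have hmod : modular M μ (fun ω => ‖combine y b.1 ω - combine y a.1 ω‖₊ / u) =
      modular (coeffMO M μ y) Measure.count fun n => ‖b.1 n - a.1 n‖₊ / u :=
    calc modular M μ (fun ω => ‖combine y b.1 ω - combine y a.1 ω‖₊ / u)
        = modular M μ fun ω => u⁻¹ * ‖combine y (b.1 - a.1) ω‖₊ :=
          lintegral_congr_ae ((combine_sub_ae hy b.1 a.1).mono fun ω hω => by
            simp only [hω, div_eq_inv_mul])
      _ = modular (coeffMO M μ y) Measure.count fun n => ‖b.1 n - a.1 n‖₊ / u := by
          simp only [modular_combine hM hy hm, div_eq_inv_mul, Pi.sub_apply]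
  exact iff_of_eq (congrArg (· < (ε : ℝ≥0∞)) hmod)

theorem coeffTopology_eq_induced (hM : IsMusielak M μ) (hy : DisjointlySupported μ y)
    (hm : ∀ n, AEStronglyMeasurable (y n) μ)
    (h : coeffSpace M μ y ⊆ moSpace 𝕜 (coeffMO M μ y) Measure.count) :
    coeffTopology M μ y =
      (moTopology 𝕜 (coeffMO M μ y) Measure.count).induced (Set.inclusion h) := by
  refine TopologicalSpace.ext_nhds fun a => ?_
  rw [coeffTopology, @nhds_induced _ _ (moTopology 𝕜 M μ),
    @nhds_induced _ _ (moTopology 𝕜 (coeffMO M μ y) Measure.count)]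
  refine ((hasBasis_nhds_moTopology hM _).comap _).eq_of_same_basis
    (((hasBasis_nhds_moTopology (isMusielak_coeffMO hM _) _).comap _).congr
      (fun _ => Iff.rfl) fun p _ => ?_)
  ext b
  exact (combine_mem_moBall_iff hM hy hm a b h p.1 p.2).symm

theorem coeffTopology_eq_induced_of_dominates (hM : IsMusielak M μ)
    (hy : DisjointlySupported μ y) (hm : ∀ n, AEStronglyMeasurable (y n) μ)
    {N : ℕ → ℝ≥0 → ℝ≥0∞} (hN : IsMusielak N Measure.count) {r : ℝ≥0} (hr : 0 < r)
    (hMr : HasLowerIndex r (modular M μ)) (hNr : HasLowerIndex r (modular N Measure.count))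
    (hNM : Dominates (modular N Measure.count) (modular (coeffMO M μ y) Measure.count))
    (hMN : Dominates (modular (coeffMO M μ y) Measure.count) (modular N Measure.count)) :
    ∃ h : coeffSpace M μ y = moSpace 𝕜 N Measure.count,
      coeffTopology M μ y = (moTopology 𝕜 N Measure.count).induced (Set.inclusion h.subset) := by
  have hA := isMusielak_coeffMO (y := y) hM Measure.count
  have hAr : HasLowerIndex r (modular (coeffMO M μ y) Measure.count) :=
    .modular (.of_forall (hasLowerIndex_coeffMO hMr))
  have hAN : moSpace 𝕜 (coeffMO M μ y) Measure.count = moSpace 𝕜 N Measure.count :=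
    (moSpace_subset_of_dominates hr hAr hMN).antisymm (moSpace_subset_of_dominates hr hNr hNM)
  have hspace := coeffSpace_eq_moSpace hM hy hm
  refine ⟨hspace.trans hAN, ?_⟩
  rw [coeffTopology_eq_induced hM hy hm hspace.subset, eq_induced_inclusion hAN
    (continuous_inclusion_of_dominates hN hA hr hNr hMN _)
    (continuous_inclusion_of_dominates hA hN hr hAr hNM _), induced_compose]
  rfl

end Disjoint

section Luxemburg

variable {Ω : Type*} [MeasurableSpace Ω] {𝕜 : Type*} [RCLike 𝕜]
  {M : Ω → ℝ≥0 → ℝ≥0∞} {μ : Measure Ω}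

theorem modular_lt_one_of_luxemburg_lt (hM : IsMusielak M μ) {f : Ω → 𝕜} {b : ℝ≥0}
    (h : luxemburg M μ f < b) : modular M μ (fun ω => b⁻¹ * ‖f ω‖₊) < 1 := by
  simp only [luxemburg, iInf_lt_iff] at h
  obtain ⟨t, ht, h1, htb⟩ := h
  refine (modular_mono hM fun ω => ?_).trans_lt h1
  have hle : t ≤ b := by exact_mod_cast htb.le
  rw [div_eq_inv_mul]
  gcongr

theorem one_le_modular_of_lt_luxemburg {f : Ω → 𝕜} {a : ℝ≥0} (ha : 0 < a)
    (h : a < luxemburg M μ f) : 1 ≤ modular M μ (fun ω => a⁻¹ * ‖f ω‖₊) := by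
  by_contra! h1
  refine h.not_ge (iInf₂_le_of_le a ha (iInf_le_of_le ?_ le_rfl))
  simpa only [div_eq_inv_mul] using h1

theorem SemiNormalized.exists_coeffMO_le_one (hM : IsMusielak M μ) {x : ℕ → Ω → 𝕜}
    (hx : SemiNormalized M μ x) : ∃ s : ℝ≥0, 0 < s ∧ ∀ n, coeffMO M μ x n s ≤ 1 := by
  obtain ⟨-, a, b, -, hab⟩ := hx
  refine ⟨(b + 1)⁻¹, by positivity, fun n => (modular_lt_one_of_luxemburg_lt hM ?_).le⟩
  exact (hab n).2.trans_lt (by exact_mod_cast lt_add_one b)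

theorem SemiNormalized.exists_one_le_coeffMO {x : ℕ → Ω → 𝕜} (hx : SemiNormalized M μ x) :
    ∃ t : ℝ≥0, ∀ n, 1 ≤ coeffMO M μ x n t := by
  obtain ⟨-, a, b, ha, hab⟩ := hx
  refine ⟨(a / 2)⁻¹, fun n => one_le_modular_of_lt_luxemburg (half_pos ha) ?_⟩
  exact lt_of_lt_of_le (by exact_mod_cast half_lt_self ha) (hab n).1

end Luxemburg

/-! ### Functions in the closed convex hull of the powers -/

section Hull

theorem psi_top : psi ∞ = 0 := by
  ext t
  simp [psi]

theorem psi_apply_of_ne_top {p : ℝ≥0∞} (hp : p ≠ ∞) (t : unitInterval) :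
    psi p t = (t : ℝ) ^ p.toReal / p.toReal :=
  if_neg hp

theorem psi_nonneg (p : ℝ≥0∞) (t : unitInterval) : 0 ≤ psi p t := by
  obtain rfl | hp := eq_or_ne p ∞
  · rw [psi_top, ContinuousMap.zero_apply]
  · rw [psi_apply_of_ne_top hp]
    exact div_nonneg (Real.rpow_nonneg t.2.1 _) ENNReal.toReal_nonneg

theorem psi_le_toReal_inv (p : ℝ≥0∞) (t : unitInterval) : psi p t ≤ p⁻¹.toReal := by
  obtain rfl | hp := eq_or_ne p ∞
  · rw [psi_top, ContinuousMap.zero_apply]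
    exact ENNReal.toReal_nonneg
  · rw [psi_apply_of_ne_top hp, ENNReal.toReal_inv, div_eq_mul_inv]
    exact mul_le_of_le_one_left (inv_nonneg.2 ENNReal.toReal_nonneg)
      (Real.rpow_le_one t.2.1 t.2.2 ENNReal.toReal_nonneg)

theorem norm_psi_le (p : ℝ≥0∞) : ‖psi p‖ ≤ p⁻¹.toReal :=
  (ContinuousMap.norm_le _ ENNReal.toReal_nonneg).2 fun t => by
    rw [Real.norm_of_nonneg (psi_nonneg p t)]
    exact psi_le_toReal_inv p t

theorem continuousAt_psi_top : ContinuousAt psi ∞ := by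
  have hlim : Tendsto (fun p : ℝ≥0∞ => p⁻¹.toReal) (𝓝 ∞) (𝓝 0) := by
    have hinv : Tendsto (fun p : ℝ≥0∞ => p⁻¹) (𝓝 ∞) (𝓝 0) :=
      ENNReal.inv_top ▸ tendsto_inv_iff.2 tendsto_id
    exact (ENNReal.tendsto_toReal ENNReal.zero_ne_top).comp hinv
  rw [ContinuousAt, psi_top]
  exact squeeze_zero_norm norm_psi_le hlim

theorem continuousOn_psi_Ioo : ContinuousOn psi (Set.Ioo 0 ∞) := by
  rw [continuousOn_iff_continuous_domRestrict]
  refine ContinuousMap.continuous_of_continuous_uncurry _ ?_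
  have hpos (z : Set.Ioo (0 : ℝ≥0∞) ∞ × unitInterval) : 0 < (z.1 : ℝ≥0∞).toReal :=
    ENNReal.toReal_pos z.1.2.1.ne' z.1.2.2.ne
  have htoReal : Continuous fun z : Set.Ioo (0 : ℝ≥0∞) ∞ × unitInterval => (z.1 : ℝ≥0∞).toReal :=
    ENNReal.continuousOn_toReal.comp_continuous (by fun_prop) fun z => z.1.2.2.ne
  refine (((continuous_subtype_val.comp continuous_snd).rpow htoReal fun z =>
    Or.inr (hpos z)).div htoReal fun z => (hpos z).ne').congr fun z => ?_
  exact (psi_apply_of_ne_top z.1.2.2.ne z.2).symm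

theorem continuousOn_psi : ContinuousOn psi {0}ᶜ := by
  intro p hp
  obtain rfl | hp' := eq_or_ne p ∞
  · exact continuousAt_psi_top.continuousWithinAt
  · exact (continuousOn_psi_Ioo.continuousAt
      (Ioo_mem_nhds (pos_iff_ne_zero.2 hp) hp'.lt_top)).continuousWithinAt

theorem isCompact_hullK {R : Set ℝ≥0∞} (hR : IsClosed R) (h0 : 0 ∉ R) : IsCompact (hullK R) := by
  have hpsi : IsCompact (psi '' R) := hR.isCompact.image_of_continuousOn
    (continuousOn_psi.mono (Set.subset_compl_singleton_iff.2 h0))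
  exact isCompact_closure_of_totallyBounded_quasiComplete (𝕜 := ℝ) hpsi.totallyBounded.convexHull

theorem convex_hullK (R : Set ℝ≥0∞) : Convex ℝ (hullK R) :=
  (convex_convexHull ℝ _).closure

theorem psi_mem_hullK {R : Set ℝ≥0∞} {p : ℝ≥0∞} (hp : p ∈ R) : psi p ∈ hullK R :=
  subset_closure (subset_convexHull ℝ _ ⟨p, hp, rfl⟩)

/-- The nonnegative functions on `[0,1]` with lower index at least `r`, in the sense of
`HasLowerIndex`. -/
def indexCone (r : ℝ≥0) : Set C(unitInterval, ℝ) :=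
  {f | ∀ s t : unitInterval, 0 ≤ f t ∧ f (s * t) ≤ (s : ℝ) ^ (r : ℝ) * f t}

theorem isClosed_indexCone (r : ℝ≥0) : IsClosed (indexCone r) := by
  simp only [indexCone, Set.ofPred_forall, Set.ofPred_and]
  exact isClosed_iInter fun s => isClosed_iInter fun t =>
    (isClosed_le continuous_const (by fun_prop)).inter (isClosed_le (by fun_prop) (by fun_prop))

theorem convex_indexCone (r : ℝ≥0) : Convex ℝ (indexCone r) := by
  intro f hf g hg a b ha hb _ s t
  obtain ⟨hf0, hf1⟩ := hf s t
  obtain ⟨hg0, hg1⟩ := hg s t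
  simp only [ContinuousMap.add_apply, ContinuousMap.smul_apply, smul_eq_mul]
  refine ⟨by positivity, ?_⟩
  calc a * f (s * t) + b * g (s * t)
      ≤ a * ((s : ℝ) ^ (r : ℝ) * f t) + b * ((s : ℝ) ^ (r : ℝ) * g t) := by gcongr
    _ = (s : ℝ) ^ (r : ℝ) * (a * f t + b * g t) := by ring

theorem psi_mem_indexCone {r : ℝ≥0} {p : ℝ≥0∞} (hp : r ≤ p) : psi p ∈ indexCone r := by
  refine fun s t => ⟨psi_nonneg p t, ?_⟩
  obtain rfl | hp' := eq_or_ne p ∞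
  · simp [psi_top]
  · have hrp : (r : ℝ) ≤ p.toReal := by
      simpa using ENNReal.toReal_mono hp' hp
    rw [psi_apply_of_ne_top hp', psi_apply_of_ne_top hp', Set.Icc.coe_mul,
      Real.mul_rpow s.2.1 t.2.1, mul_div_assoc]
    exact mul_le_mul_of_nonneg_right
      (Real.rpow_le_rpow_of_exponent_ge' s.2.1 s.2.2 r.coe_nonneg hrp)
      (div_nonneg (Real.rpow_nonneg t.2.1 _) ENNReal.toReal_nonneg)

theorem hullK_subset_indexCone {r : ℝ≥0} {R : Set ℝ≥0∞} (hR : ∀ p ∈ R, r ≤ p) :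
    hullK R ⊆ indexCone r :=
  closure_minimal (convexHull_min (Set.image_subset_iff.2 fun p hp =>
    psi_mem_indexCone (hR p hp)) (convex_indexCone r)) (isClosed_indexCone r)

theorem indexCone_nonneg {r : ℝ≥0} {f : C(unitInterval, ℝ)} (hf : f ∈ indexCone r) : 0 ≤ f :=
  fun t => (hf 0 t).1

theorem indexCone_monotone {r : ℝ≥0} {f : C(unitInterval, ℝ)} (hf : f ∈ indexCone r) :
    Monotone f := by
  intro s t hst
  obtain rfl | ht := eq_or_ne t 0
  · rw [le_antisymm hst unitInterval.nonneg']
  · have ht0 : 0 < (t : ℝ) := unitInterval.coe_pos.2 (unitInterval.pos_iff_ne_zero.2 ht)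
    let q : unitInterval := ⟨s / t, div_nonneg s.2.1 ht0.le, (div_le_one ht0).2 hst⟩
    have hs : q * t = s := Subtype.ext (div_mul_cancel₀ _ ht0.ne')
    calc f s ≤ (q : ℝ) ^ (r : ℝ) * f t := hs ▸ (hf q t).2
      _ ≤ f t := mul_le_of_le_one_left (hf q t).1 (Real.rpow_le_one q.2.1 q.2.2 r.coe_nonneg)

theorem indexCone_map_zero {r : ℝ≥0} (hr : 0 < r) {f : C(unitInterval, ℝ)}
    (hf : f ∈ indexCone r) : f 0 = 0 := by
  refine le_antisymm ?_ (hf 0 0).1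
  have h := (hf 0 0).2
  rwa [mul_zero, Set.Icc.coe_zero, Real.zero_rpow (by exact_mod_cast hr.ne'), zero_mul] at h

end Hull

section ExtendTop

/-- The extension by `∞` to `[0,∞)` of a nonnegative function on `[0,1]`. -/
noncomputable def extendTop (f : C(unitInterval, ℝ)) (t : ℝ≥0) : ℝ≥0∞ :=
  if t ≤ 1 then ENNReal.ofReal (f (Set.projIcc 0 1 zero_le_one t)) else ∞

variable {f g : C(unitInterval, ℝ)} {r t : ℝ≥0}

theorem extendTop_of_le (f : C(unitInterval, ℝ)) (ht : t ≤ 1) :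
    extendTop f t = ENNReal.ofReal (f ⟨t, t.2, ht⟩) := by
  rw [extendTop, if_pos ht]
  exact congrArg (fun s => ENNReal.ofReal (f s)) (Set.projIcc_of_mem zero_le_one ⟨t.2, ht⟩)

theorem extendTop_of_lt (f : C(unitInterval, ℝ)) (ht : 1 < t) : extendTop f t = ∞ :=
  if_neg ht.not_ge

theorem continuous_ofReal_projIcc (f : C(unitInterval, ℝ)) :
    Continuous fun t : ℝ≥0 => ENNReal.ofReal (f (Set.projIcc 0 1 zero_le_one t)) :=
  ENNReal.continuous_ofReal.comp (f.continuous.comp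
    (continuous_projIcc.comp NNReal.continuous_coe))

theorem extendTop_mono (h : f ≤ g) (t : ℝ≥0) : extendTop f t ≤ extendTop g t := by
  rcases le_or_gt t 1 with ht | ht
  · rw [extendTop_of_le f ht, extendTop_of_le g ht]
    exact ENNReal.ofReal_le_ofReal (h _)
  · rw [extendTop_of_lt g ht]
    exact le_top

theorem extendTop_smul {m : ℝ≥0} (hm : m ≠ 0) (f : C(unitInterval, ℝ)) (t : ℝ≥0) :
    extendTop (m • f) t = m * extendTop f t := by
  rcases le_or_gt t 1 with ht | ht
  · rw [extendTop_of_le _ ht, extendTop_of_le f ht, ContinuousMap.smul_apply, NNReal.smul_def,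
      smul_eq_mul, ENNReal.ofReal_mul m.coe_nonneg, ENNReal.ofReal_coe_nnreal]
  · rw [extendTop_of_lt _ ht, extendTop_of_lt f ht,
      ENNReal.mul_top (ENNReal.coe_ne_zero.2 hm)]

theorem extendTop_le_add_ofReal_dist (f g : C(unitInterval, ℝ)) (t : ℝ≥0) :
    extendTop f t ≤ extendTop g t + ENNReal.ofReal (dist f g) := by
  rcases le_or_gt t 1 with ht | ht
  · rw [extendTop_of_le f ht, extendTop_of_le g ht]
    refine le_trans (ENNReal.ofReal_le_ofReal ?_) ENNReal.ofReal_add_le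
    exact sub_le_iff_le_add'.1 ((Real.sub_le_dist _ _).trans
      (ContinuousMap.dist_apply_le_dist (f := f) (g := g) _))
  · rw [extendTop_of_lt g ht, top_add]
    exact le_top

theorem hasLowerIndex_extendTop (hf : f ∈ indexCone r) : HasLowerIndex r (extendTop f) := by
  intro s hs0 hs1 t
  have hs0' : (0 : ℝ≥0∞) < s := by exact_mod_cast hs0
  rw [smul_eq_mul]
  rcases le_or_gt t 1 with ht | ht
  · rw [extendTop_of_le f ht, extendTop_of_le f (mul_le_one' hs1 ht),
      ← ENNReal.ofReal_coe_nnreal, ENNReal.ofReal_rpow_of_pos (by exact_mod_cast hs0),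
      ← ENNReal.ofReal_mul (by positivity)]
    exact ENNReal.ofReal_le_ofReal (hf ⟨s, s.2, hs1⟩ ⟨t, t.2, ht⟩).2
  · rw [extendTop_of_lt f ht,
      ENNReal.mul_top (ENNReal.rpow_pos hs0' ENNReal.coe_ne_top).ne']
    exact le_top

theorem monotone_extendTop (hf : f ∈ indexCone r) : Monotone (extendTop f) := by
  intro s t hst
  rcases le_or_gt t 1 with ht | ht
  · rw [extendTop_of_le f ht, extendTop_of_le f (hst.trans ht)]
    exact ENNReal.ofReal_le_ofReal (indexCone_monotone hf hst)
  · rw [extendTop_of_lt f ht]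
    exact le_top

theorem extendTop_map_zero (hr : 0 < r) (hf : f ∈ indexCone r) : extendTop f 0 = 0 := by
  rw [extendTop_of_le f zero_le_one]
  exact ENNReal.ofReal_eq_zero.2 (indexCone_map_zero hr hf).le

theorem isOrlicz_extendTop (hr : 0 < r) (hf : f ∈ indexCone r) : IsOrlicz (extendTop f) where
  monotone := monotone_extendTop hf
  left_cont t := by
    rcases le_or_gt t 1 with ht | ht
    · exact (continuous_ofReal_projIcc f).continuousWithinAt.congr
        (fun s hs => if_pos ((Set.mem_Iio.1 hs).le.trans ht)) (if_pos ht)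
    · refine (continuousAt_const.congr (f := fun _ => ∞) ?_).continuousWithinAt
      filter_upwards [lt_mem_nhds ht] with s hs
      exact (extendTop_of_lt f hs).symm
  tendsto_zero := by
    rw [← extendTop_map_zero hr hf]
    refine ((continuous_ofReal_projIcc f).continuousAt.congr ?_).tendsto.mono_left
      nhdsWithin_le_nhds
    filter_upwards [ge_mem_nhds zero_lt_one] with t ht
    exact (if_pos ht).symm
  exists_pos := ⟨2, by rw [extendTop_of_lt f one_lt_two]; exact ENNReal.zero_lt_top⟩

theorem extendTop_mem_orliczClass (hr : 0 < r) {R : Set ℝ≥0∞} (hR : ∀ p ∈ R, r ≤ p)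
    (hf : f ∈ hullK R) : extendTop f ∈ orliczClass R := by
  refine ⟨isOrlicz_extendTop hr (hullK_subset_indexCone hR hf), 1, one_pos, le_rfl, f, hf, 1,
    one_pos, fun t _ => ?_⟩
  have heq : extendTop f (Real.toNNReal t) = ENNReal.ofReal (f t) := by
    rw [extendTop_of_le f (Real.toNNReal_le_one.2 t.2.2)]
    congr 2
    exact Subtype.ext (Real.coe_toNNReal _ t.2.1)
  simp [heq]

end ExtendTop

/-! ### The modular of a variable exponent space as an integral of powers -/

section Potential

variable {p : ℝ≥0∞} {t : ℝ≥0}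

theorem potential_of_ne_top (hp : p ≠ ∞) (t : ℝ≥0) : potential p t = (t : ℝ≥0∞) ^ p.toReal :=
  if_neg hp

theorem potential_top_of_le (ht : t ≤ 1) : potential ∞ t = 0 := by
  simp [potential, ht]

theorem potential_top_of_lt (ht : 1 < t) : potential ∞ t = ∞ := by
  simp [potential, ht.not_ge]

theorem potential_map_zero (hp : p ≠ 0) : potential p 0 = 0 := by
  obtain rfl | hp' := eq_or_ne p ∞
  · exact potential_top_of_le zero_le_one
  · rw [potential_of_ne_top hp', ENNReal.coe_zero,
      ENNReal.zero_rpow_of_pos (ENNReal.toReal_pos hp hp')]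

theorem potential_monotone (p : ℝ≥0∞) : Monotone (potential p) := by
  intro s t hst
  obtain rfl | hp := eq_or_ne p ∞
  · rcases le_or_gt t 1 with ht | ht
    · rw [potential_top_of_le ht, potential_top_of_le (hst.trans ht)]
    · rw [potential_top_of_lt ht]
      exact le_top
  · rw [potential_of_ne_top hp, potential_of_ne_top hp]
    gcongr

theorem measurable_potential : Measurable fun z : ℝ≥0∞ × ℝ≥0 => potential z.1 z.2 := by
  unfold potential
  refine Measurable.ite (measurable_fst (measurableSet_singleton _)) ?_ (by fun_prop)
  exact Measurable.ite (measurable_snd measurableSet_Iic) measurable_const measurable_const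

theorem hasLowerIndex_potential {r : ℝ≥0} (hp : r ≤ p) : HasLowerIndex r (potential p) := by
  intro s hs0 hs1 t
  have hs0' : (0 : ℝ≥0∞) < s := by exact_mod_cast hs0
  rw [smul_eq_mul]
  obtain rfl | hp' := eq_or_ne p ∞
  · rcases le_or_gt t 1 with ht | ht
    · rw [potential_top_of_le (mul_le_one' hs1 ht)]
      exact zero_le
    · rw [potential_top_of_lt ht,
        ENNReal.mul_top (ENNReal.rpow_pos hs0' ENNReal.coe_ne_top).ne']
      exact le_top
  · have hrp : (r : ℝ) ≤ p.toReal := by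
      simpa using ENNReal.toReal_mono hp' hp
    rw [potential_of_ne_top hp', potential_of_ne_top hp', ENNReal.coe_mul,
      ENNReal.mul_rpow_of_nonneg _ _ ENNReal.toReal_nonneg]
    gcongr ?_ * _
    exact ENNReal.rpow_le_rpow_of_exponent_ge (by exact_mod_cast hs1) hrp

theorem self_le_two_rpow {p : ℝ} (hp : 0 ≤ p) : p ≤ 2 ^ p := by
  rcases le_total p 1 with h | h
  · exact h.trans (Real.one_le_rpow one_le_two hp)
  · have hbernoulli := one_add_mul_self_le_rpow_one_add (s := 1) (by norm_num) h
    norm_num at hbernoulli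
    linarith

theorem mul_potential_half_le (p : ℝ≥0∞) (t : ℝ≥0) :
    p * potential p (t / 2) ≤ potential p t := by
  obtain rfl | hp := eq_or_ne p ∞
  · rcases le_or_gt t 1 with ht | ht
    · rw [potential_top_of_le (NNReal.half_le_self t |>.trans ht), mul_zero]
      exact zero_le
    · rw [potential_top_of_lt ht]
      exact le_top
  · have htwo : p ≤ (2 : ℝ≥0∞) ^ p.toReal := by
      rw [← ENNReal.ofReal_ofNat 2, ENNReal.ofReal_rpow_of_pos two_pos,
        ENNReal.le_ofReal_iff_toReal_le hp (by positivity)]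
      exact self_le_two_rpow ENNReal.toReal_nonneg
    calc p * potential p (t / 2)
        ≤ (2 : ℝ≥0∞) ^ p.toReal * ((t / 2 : ℝ≥0) : ℝ≥0∞) ^ p.toReal := by
          rw [potential_of_ne_top hp]; gcongr
      _ = potential p t := by
          rw [← ENNReal.mul_rpow_of_nonneg _ _ ENNReal.toReal_nonneg, ← ENNReal.coe_ofNat,
            ← ENNReal.coe_mul, mul_div_cancel₀ _ two_ne_zero, potential_of_ne_top hp]

theorem potential_mul_eq {g : ℝ≥0} (hp : p ≠ 0) (hg : p = ∞ → g ≤ 1) (ht : t ≤ 1) :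
    potential p (t * g) = p * potential p g * extendTop (psi p) t := by
  rw [extendTop_of_le _ ht]
  obtain rfl | hp' := eq_or_ne p ∞
  · rw [psi_top, ContinuousMap.zero_apply, ENNReal.ofReal_zero, mul_zero,
      potential_top_of_le (mul_le_one' ht (hg rfl))]
  · rw [potential_of_ne_top hp', potential_of_ne_top hp', psi_apply_of_ne_top hp',
      ENNReal.coe_mul, ENNReal.mul_rpow_of_nonneg _ _ ENNReal.toReal_nonneg,
      ENNReal.ofReal_div_of_pos (ENNReal.toReal_pos hp hp'), ENNReal.ofReal_toReal hp',
      ← ENNReal.ofReal_rpow_of_nonneg t.coe_nonneg ENNReal.toReal_nonneg,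
      ENNReal.ofReal_coe_nnreal, mul_comm p, mul_assoc, ENNReal.mul_div_cancel hp hp', mul_comm]

theorem potential_mul_le {r q K : ℝ≥0} (hr : 0 < r) (hrp : r ≤ p) (hpq : p ≤ q) (hK : 1 ≤ K)
    (g : ℝ≥0) : potential p (K * g) ≤ (K ^ (q : ℝ) / r : ℝ≥0) * (p * potential p g) := by
  have hp : p ≠ ∞ := ne_top_of_le_ne_top ENNReal.coe_ne_top hpq
  lift p to ℝ≥0 using hp
  rw [ENNReal.coe_le_coe] at hrp hpq
  have hconst : K ^ (p : ℝ) ≤ K ^ (q : ℝ) / r * p :=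
    calc K ^ (p : ℝ) ≤ K ^ (q : ℝ) := NNReal.rpow_le_rpow_of_exponent_le hK (by exact_mod_cast hpq)
      _ = K ^ (q : ℝ) / r * r := (div_mul_cancel₀ _ hr.ne').symm
      _ ≤ K ^ (q : ℝ) / r * p := by gcongr
  rw [potential_of_ne_top ENNReal.coe_ne_top, potential_of_ne_top ENNReal.coe_ne_top,
    ENNReal.coe_mul, ENNReal.mul_rpow_of_nonneg _ _ ENNReal.toReal_nonneg, ← mul_assoc,
    ENNReal.coe_toReal, ← ENNReal.coe_rpow_of_nonneg K p.coe_nonneg, ← ENNReal.coe_mul]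
  gcongr

end Potential

section Exponent

variable {Ω : Type*} [MeasurableSpace Ω] {μ : Measure Ω} {P : Ω → ℝ≥0∞} {g : Ω → ℝ≥0} {r : ℝ≥0}

theorem ae_mem_essRange (hPm : AEMeasurable P μ) : ∀ᵐ ω ∂μ, P ω ∈ essRange P μ :=
  ae_of_ae_map hPm Measure.support_mem_ae

theorem ae_ne_zero_of_le_essRange (hPm : AEMeasurable P μ) (hr : 0 < r)
    (hR : ∀ p ∈ essRange P μ, r ≤ p) : ∀ᵐ ω ∂μ, P ω ≠ 0 :=
  (ae_mem_essRange hPm).mono fun _ hω => ((ENNReal.coe_pos.2 hr).trans_le (hR _ hω)).ne'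

theorem isMusielak_expMO (hPm : Measurable P) (hP : ∀ᵐ ω ∂μ, P ω ≠ 0) :
    IsMusielak (expMO P) μ where
  monotone _ := potential_monotone _
  map_zero := hP.mono fun _ => potential_map_zero
  measurable := measurable_potential.comp ((hPm.comp measurable_fst).prodMk measurable_snd)

theorem ae_le_one_of_modular_expMO_ne_top (hPm : Measurable P) (hg : AEMeasurable g μ)
    (h : modular (expMO P) μ g ≠ ∞) : ∀ᵐ ω ∂μ, P ω = ∞ → g ω ≤ 1 := by
  have hmeas : AEMeasurable (fun ω => potential (P ω) (g ω)) μ :=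
    measurable_potential.comp_aemeasurable (hPm.aemeasurable.prodMk hg)
  filter_upwards [ae_lt_top' hmeas h] with ω hω hPω
  by_contra! hgω
  rw [hPω, potential_top_of_lt hgω] at hω
  exact lt_irrefl _ hω

/-- The measure on exponents that represents `τ ↦ ρ_P(τ g)`, for `τ ∈ [0,1]`, as an integral of
the functions `ψ_p`. The factor `P` in the density makes up for the `1 / p` in `ψ_p`. -/
noncomputable def exponentMeasure (P : Ω → ℝ≥0∞) (μ : Measure Ω) (g : Ω → ℝ≥0) : Measure ℝ≥0∞ :=
  (μ.withDensity fun ω => P ω * potential (P ω) (g ω)).map P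

theorem exponentMeasure_univ (hPm : Measurable P) (μ : Measure Ω) (g : Ω → ℝ≥0) :
    exponentMeasure P μ g Set.univ = ∫⁻ ω, P ω * potential (P ω) (g ω) ∂μ := by
  rw [exponentMeasure, Measure.map_apply hPm .univ, Set.preimage_univ,
    withDensity_apply _ .univ, Measure.restrict_univ]

theorem ae_exponentMeasure_mem_essRange (hPm : Measurable P) (μ : Measure Ω) (g : Ω → ℝ≥0) :
    ∀ᵐ p ∂exponentMeasure P μ g, p ∈ essRange P μ :=
  ((withDensity_absolutelyContinuous _ _).map hPm).ae_le Measure.support_mem_ae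

theorem exponentMeasure_half_univ_le (hPm : Measurable P) (μ : Measure Ω) (g : Ω → ℝ≥0) :
    exponentMeasure P μ (fun ω => g ω / 2) Set.univ ≤ modular (expMO P) μ g := by
  rw [exponentMeasure_univ hPm]
  exact lintegral_mono fun ω => mul_potential_half_le _ _

theorem modular_expMO_le_mul_exponentMeasure_univ {q K : ℝ≥0} (hPm : Measurable P) (hr : 0 < r)
    (hrP : ∀ᵐ ω ∂μ, r ≤ P ω) (hPq : ∀ᵐ ω ∂μ, P ω ≤ q) (hK : 1 ≤ K) (g : Ω → ℝ≥0) :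
    modular (expMO P) μ (fun ω => K * g ω) ≤
      (K ^ (q : ℝ) / r : ℝ≥0) * exponentMeasure P μ g Set.univ := by
  rw [exponentMeasure_univ hPm, ← lintegral_const_mul' _ _ ENNReal.coe_ne_top]
  refine lintegral_mono_ae ?_
  filter_upwards [hrP, hPq] with ω hrω hqω
  exact potential_mul_le hr hrω hqω hK _

theorem measurable_psi_apply (t : unitInterval) : Measurable fun p => psi p t :=
  Measurable.ite (measurableSet_singleton _) measurable_const (by fun_prop)

theorem modular_expMO_mul_eq_lintegral (hPm : Measurable P) (hP : ∀ᵐ ω ∂μ, P ω ≠ 0)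
    (hg : AEMeasurable g μ) (htop : ∀ᵐ ω ∂μ, P ω = ∞ → g ω ≤ 1) {τ : ℝ≥0} (hτ : τ ≤ 1) :
    modular (expMO P) μ (fun ω => τ * g ω) =
      ∫⁻ p, extendTop (psi p) τ ∂exponentMeasure P μ g := by
  have hpsi : Measurable fun p => extendTop (psi p) τ := by
    simp only [extendTop_of_le _ hτ]
    exact (measurable_psi_apply _).ennreal_ofReal
  have hdensity : AEMeasurable (fun ω => P ω * potential (P ω) (g ω)) μ :=
    hPm.aemeasurable.mul (measurable_potential.comp_aemeasurable (hPm.aemeasurable.prodMk hg))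
  rw [exponentMeasure, lintegral_map hpsi hPm, lintegral_withDensity_eq_lintegral_mul₀ hdensity
    (g := fun ω => extendTop (psi (P ω)) τ) (hpsi.comp hPm).aemeasurable]
  refine lintegral_congr_ae ?_
  filter_upwards [hP, htop] with ω hω htopω
  exact potential_mul_eq hω htopω hτ

end Exponent

section Barycenter

variable {ν : Measure ℝ≥0∞} {R : Set ℝ≥0∞}

theorem integrable_psi [IsFiniteMeasure ν] {r : ℝ≥0} (hr : 0 < r)
    (hν : ∀ᵐ p ∂ν, (r : ℝ≥0∞) ≤ p) :
    Integrable psi ν := by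
  have hmeas : AEStronglyMeasurable psi ν := by
    have hne : ∀ᵐ p ∂ν, p ∈ ({0}ᶜ : Set ℝ≥0∞) := hν.mono fun p hp =>
      ((ENNReal.coe_pos.2 hr).trans_le hp).ne'
    rw [← Measure.restrict_eq_self_of_ae_mem hne]
    exact continuousOn_psi.aestronglyMeasurable (measurableSet_singleton 0).compl
  refine .of_bound hmeas (r : ℝ≥0∞)⁻¹.toReal (hν.mono fun p hp => (norm_psi_le p).trans ?_)
  exact ENNReal.toReal_mono (by simpa using hr.ne') (ENNReal.inv_le_inv.2 hp)

theorem lintegral_extendTop_psi (hpsi : Integrable psi ν) {t : ℝ≥0} (ht : t ≤ 1) :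
    ∫⁻ p, extendTop (psi p) t ∂ν = extendTop (∫ p, psi p ∂ν) t := by
  simp only [extendTop_of_le _ ht]
  rw [ContinuousMap.integral_apply hpsi]
  exact (ofReal_integral_eq_lintegral_ofReal ((ContinuousMap.evalCLM ℝ _).integrable_comp hpsi)
    (.of_forall fun p => psi_nonneg p _)).symm

theorem average_psi_mem_hullK [IsFiniteMeasure ν] [NeZero ν] (hpsi : Integrable psi ν)
    (hν : ∀ᵐ p ∂ν, p ∈ R) : ⨍ p, psi p ∂ν ∈ hullK R :=
  (convex_hullK R).average_mem isClosed_closure (hν.mono fun _ => psi_mem_hullK) hpsi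

theorem hullK_nonneg {φ : C(unitInterval, ℝ)} (hφ : φ ∈ hullK R) : 0 ≤ φ :=
  indexCone_nonneg (hullK_subset_indexCone (r := 0) (fun _ _ => by simp) hφ)

theorem smul_le_self_of_mem_hullK {φ : C(unitInterval, ℝ)} (hφ : φ ∈ hullK R) {m : ℝ≥0}
    (hm : m ≤ 1) : m • φ ≤ φ :=
  fun t => mul_le_of_le_one_left (hullK_nonneg hφ t) (by exact_mod_cast hm)

theorem integral_psi_mem_hullK_of_top_mem [IsFiniteMeasure ν] (hpsi : Integrable psi ν)
    (hν : ∀ᵐ p ∂ν, p ∈ R) (hν1 : ν.real Set.univ ≤ 1) (htop : ∞ ∈ R) :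
    ∫ p, psi p ∂ν ∈ hullK R := by
  have hzero : (0 : C(unitInterval, ℝ)) ∈ hullK R := psi_top ▸ psi_mem_hullK htop
  obtain rfl | hne := eq_or_ne ν 0
  · rwa [integral_zero_measure]
  · have : NeZero ν := ⟨hne⟩
    rw [← measure_smul_average]
    exact (convex_hullK R).smul_mem_of_zero_mem hzero (average_psi_mem_hullK hpsi hν)
      ⟨measureReal_nonneg, hν1⟩

/-- When `∞ ∈ R` the integral needs no normalization since `ψ_∞ = 0`. -/
theorem exists_mem_hullK_integral_psi_le [IsFiniteMeasure ν] (hpsi : Integrable psi ν)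
    (hν : ∀ᵐ p ∂ν, p ∈ R) (hν1 : ν.real Set.univ ≤ 1) {m : ℝ≥0} (hm0 : 0 < m) (hm1 : m ≤ 1)
    (h : ∞ ∈ R ∨ m ≤ ν.real Set.univ) :
    ∃ φ ∈ hullK R, ∫ p, psi p ∂ν ≤ φ ∧ m • φ ≤ ∫ p, psi p ∂ν := by
  rcases h with htop | hm
  · have hmem := integral_psi_mem_hullK_of_top_mem hpsi hν hν1 htop
    exact ⟨_, hmem, le_rfl, smul_le_self_of_mem_hullK hmem hm1⟩
  · have : NeZero ν := ⟨by
      rintro rfl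
      exact (NNReal.coe_pos.2 hm0).not_ge (by simpa using hm)⟩
    have hmem := average_psi_mem_hullK hpsi hν
    refine ⟨_, hmem, ?_, ?_⟩ <;> rw [← measure_smul_average]
    · exact smul_le_self_of_mem_hullK (m := ⟨ν.real Set.univ, measureReal_nonneg⟩) hmem hν1
    · exact fun t => mul_le_mul_of_nonneg_right hm (hullK_nonneg hmem t)

end Barycenter

section Sandwich

variable {Ω : Type*} [MeasurableSpace Ω] {μ : Measure Ω} {P : Ω → ℝ≥0∞} {r : ℝ≥0}

theorem exists_essRange_le_coe (htop : ∞ ∉ essRange P μ) :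
    ∃ q : ℝ≥0, ∀ p ∈ essRange P μ, p ≤ q := by
  obtain hempty | hne := (essRange P μ).eq_empty_or_nonempty
  · exact ⟨0, by simp [hempty]⟩
  · have hmem : sSup (essRange P μ) ∈ essRange P μ :=
      Measure.isClosed_support.isCompact.sSup_mem hne
    refine ⟨(sSup (essRange P μ)).toNNReal, fun p hp => ?_⟩
    rw [ENNReal.coe_toNNReal fun h => htop (h ▸ hmem)]
    exact le_sSup hp

theorem exists_le_exponentMeasure_univ (hPm : Measurable P) (hr : 0 < r)
    (hrP : ∀ᵐ ω ∂μ, r ≤ P ω) {K : ℝ≥0} (hK : 1 ≤ K) :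
    ∃ m : ℝ≥0, 0 < m ∧ m ≤ 1 ∧ (∞ ∈ essRange P μ ∨ ∀ g : Ω → ℝ≥0,
      1 ≤ modular (expMO P) μ (fun ω => K * g ω) → m ≤ exponentMeasure P μ g Set.univ) := by
  by_cases htop : ∞ ∈ essRange P μ
  · exact ⟨1, one_pos, le_rfl, .inl htop⟩
  · obtain ⟨q, hq⟩ := exists_essRange_le_coe htop
    have hPq : ∀ᵐ ω ∂μ, P ω ≤ q := (ae_mem_essRange hPm.aemeasurable).mono fun _ => hq _
    have hC : 0 < K ^ (q : ℝ) / r := div_pos (NNReal.rpow_pos (one_pos.trans_le hK)) hr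
    refine ⟨min 1 (K ^ (q : ℝ) / r)⁻¹, lt_min one_pos (inv_pos.2 hC), min_le_left _ _,
      .inr fun g hg => (ENNReal.coe_le_coe.2 (min_le_right _ _)).trans ?_⟩
    rw [ENNReal.coe_inv hC.ne', ENNReal.inv_le_iff_le_mul (fun _ => ENNReal.coe_ne_zero.2 hC.ne')
      fun h => absurd h ENNReal.coe_ne_top]
    exact hg.trans (modular_expMO_le_mul_exponentMeasure_univ hPm hr hrP hPq hK g)

theorem exists_mem_hullK_modular_expMO_le (hPm : Measurable P) (hr : 0 < r)
    (hR : ∀ p ∈ essRange P μ, r ≤ p) {s t : ℝ≥0} (hs : 0 < s) (hst : s ≤ t) :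
    ∃ m : ℝ≥0, 0 < m ∧ ∀ g : Ω → ℝ≥0, AEMeasurable g μ →
      modular (expMO P) μ (fun ω => s * g ω) ≤ 1 → 1 ≤ modular (expMO P) μ (fun ω => t * g ω) →
      ∃ φ ∈ hullK (essRange P μ), ∀ τ ≤ 1,
        modular (expMO P) μ (fun ω => τ * (s * g ω / 2)) ≤ extendTop φ τ ∧
        m * extendTop φ τ ≤ modular (expMO P) μ (fun ω => τ * (s * g ω / 2)) := by
  have hrP : ∀ᵐ ω ∂μ, r ≤ P ω := (ae_mem_essRange hPm.aemeasurable).mono fun _ => hR _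
  have hP0 : ∀ᵐ ω ∂μ, P ω ≠ 0 := ae_ne_zero_of_le_essRange hPm.aemeasurable hr hR
  have hK : 1 ≤ 2 * (t / s) := one_le_two.trans
    (le_mul_of_one_le_right zero_le_two ((one_le_div hs).2 hst))
  obtain ⟨m, hm0, hm1, hm⟩ := exists_le_exponentMeasure_univ hPm hr hrP hK
  refine ⟨m, hm0, fun g hg hgs hgt => ?_⟩
  have hsg : AEMeasurable (fun ω => s * g ω) μ := hg.const_mul s
  have htop : ∀ᵐ ω ∂μ, P ω = ∞ → s * g ω / 2 ≤ 1 :=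
    (ae_le_one_of_modular_expMO_ne_top hPm hsg (hgs.trans_lt ENNReal.one_lt_top).ne).mono
      fun ω h hω => (NNReal.half_le_self _).trans (h hω)
  set ν := exponentMeasure P μ fun ω => s * g ω / 2
  have hν1 : ν Set.univ ≤ 1 := (exponentMeasure_half_univ_le hPm μ _).trans hgs
  have : IsFiniteMeasure ν := ⟨hν1.trans_lt ENNReal.one_lt_top⟩
  have hνR : ∀ᵐ p ∂ν, p ∈ essRange P μ := ae_exponentMeasure_mem_essRange hPm μ _
  have hmass : ∞ ∈ essRange P μ ∨ m ≤ ν.real Set.univ := hm.imp_right fun h => by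
    have hscale : ∀ ω, 2 * (t / s) * (s * g ω / 2) = t * g ω := fun ω => by field_simp
    exact ENNReal.toReal_mono (measure_ne_top _ _) (h _ (by simpa only [hscale] using hgt))
  have hpsi : Integrable psi ν := integrable_psi hr (hνR.mono fun _ => hR _)
  obtain ⟨φ, hφ, hle, hge⟩ := exists_mem_hullK_integral_psi_le hpsi hνR
    (ENNReal.toReal_le_of_le_ofReal zero_le_one (by simpa using hν1)) hm0 hm1 hmass
  refine ⟨φ, hφ, fun τ hτ => ?_⟩
  rw [modular_expMO_mul_eq_lintegral hPm hP0 (hsg.div_const 2) htop hτ,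
    lintegral_extendTop_psi hpsi hτ, ← extendTop_smul hm0.ne']
  exact ⟨extendTop_mono hle τ, extendTop_mono hge τ⟩

end Sandwich

/-! ### Sequences of coefficients -/

section Subsequence

theorem exists_strictMono_forall_dist_lt {X : Type*} [PseudoMetricSpace X] {K : Set X}
    (hK : IsCompact K) {u : ℕ → X} (hu : ∀ n, u n ∈ K) {ε : ℕ → ℝ} (hε : ∀ n, 0 < ε n) :
    ∃ a ∈ K, ∃ σ : ℕ → ℕ, StrictMono σ ∧ ∀ n, dist (u (σ n)) a < ε n := by
  obtain ⟨a, ha, τ, hτ, hlim⟩ := hK.tendsto_subseq hu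
  obtain ⟨ι, hι, hdist⟩ := extraction_forall_of_eventually
    (P := fun n k => dist (u (τ k)) a < ε n)
    fun n => hlim.eventually (Metric.ball_mem_nhds a (hε n))
  exact ⟨a, ha, τ ∘ ι, hτ.comp hι, hdist⟩

theorem tsum_ofReal_ne_top_of_lt_half_pow {d : ℕ → ℝ} (h : ∀ n, d n < (1 / 2) ^ n) :
    ∑' n, ENNReal.ofReal (d n) ≠ ∞ := by
  have hgeom : ∑' n : ℕ, ENNReal.ofReal ((1 / 2 : ℝ) ^ n) ≠ ∞ := by
    rw [← ENNReal.ofReal_tsum_of_nonneg (fun n => by positivity) summable_geometric_two]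
    exact ENNReal.ofReal_ne_top
  exact ne_top_of_le_ne_top hgeom (ENNReal.tsum_le_tsum fun n => ENNReal.ofReal_le_ofReal (h n).le)

variable {A : ℕ → ℝ≥0 → ℝ≥0∞} {φ : ℕ → C(unitInterval, ℝ)} {ψ : C(unitInterval, ℝ)}

theorem dominates_extendTop_of_tsum_dist_ne_top
    (hdist : ∑' n, ENNReal.ofReal (dist (φ n) ψ) ≠ ∞) {k : ℝ≥0} (hk : 0 < k)
    (h : ∀ n, ∀ t ≤ 1, A n (k * t) ≤ extendTop (φ n) t) :
    Dominates (modular (fun _ => extendTop ψ) Measure.count) (modular A Measure.count) := by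
  refine dominates_modular_count hk (C := 1) hdist fun n t ht => ?_
  have ht1 : t ≤ 1 := by
    by_contra! ht1
    exact ENNReal.one_lt_top.not_gt (extendTop_of_lt ψ ht1 ▸ ht)
  rw [ENNReal.coe_one, one_mul]
  exact (h n t ht1).trans (extendTop_le_add_ofReal_dist _ _ _)

theorem dominates_of_tsum_dist_extendTop_ne_top
    (hdist : ∑' n, ENNReal.ofReal (dist (φ n) ψ) ≠ ∞) (hmono : ∀ n, Monotone (A n))
    {k T m : ℝ≥0} (hk : 0 < k) (hkT : k ≤ T) (hT : ∀ n, 1 ≤ A n T) (hm : 0 < m)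
    (h : ∀ n, ∀ t ≤ 1, m * extendTop (φ n) t ≤ A n (k * t)) :
    Dominates (modular A Measure.count) (modular (fun _ => extendTop ψ) Measure.count) := by
  have hT0 : 0 < T := hk.trans_le hkT
  refine dominates_modular_count (inv_pos.2 hT0) (C := m⁻¹) hdist fun n t ht => ?_
  have htT : t ≤ T := ((hmono n).reflect_lt (ht.trans_le (hT n))).le
  have hφ : extendTop (φ n) (T⁻¹ * t) ≤ (m⁻¹ : ℝ≥0) * A n t :=
    calc extendTop (φ n) (T⁻¹ * t) = (m⁻¹ : ℝ≥0) * (m * extendTop (φ n) (T⁻¹ * t)) := by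
          rw [← mul_assoc, ← ENNReal.coe_mul, inv_mul_cancel₀ hm.ne', ENNReal.coe_one, one_mul]
      _ ≤ (m⁻¹ : ℝ≥0) * A n (k * (T⁻¹ * t)) := by
          gcongr
          exact h n _ ((inv_mul_le_one₀ hT0).2 htT)
      _ ≤ (m⁻¹ : ℝ≥0) * A n t := by
          gcongr
          refine hmono n ?_
          rw [← mul_assoc, ← div_eq_mul_inv]
          exact mul_le_of_le_one_left' ((div_le_one hT0).2 hkT)
  refine (extendTop_le_add_ofReal_dist ψ (φ n) _).trans ?_
  rw [dist_comm]
  gcongr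

end Subsequence

section VariableExponent

variable {Ω : Type*} [MeasurableSpace Ω] {𝕜 : Type*} [RCLike 𝕜] {μ : Measure Ω} {P : Ω → ℝ≥0∞}
  {x : ℕ → Ω → 𝕜} {r : ℝ≥0}

theorem exists_mem_hullK_coeffMO_le (hPm : Measurable P) (hr : 0 < r)
    (hR : ∀ p ∈ essRange P μ, r ≤ p) (hx : ∀ n, AEStronglyMeasurable (x n) μ) {s t : ℝ≥0}
    (hs0 : 0 < s) (hst : s ≤ t) (hs : ∀ n, coeffMO (expMO P) μ x n s ≤ 1)
    (ht : ∀ n, 1 ≤ coeffMO (expMO P) μ x n t) :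
    ∃ m : ℝ≥0, 0 < m ∧ ∃ φ : ℕ → C(unitInterval, ℝ), ∀ n, φ n ∈ hullK (essRange P μ) ∧
      ∀ τ ≤ 1, coeffMO (expMO P) μ x n (s / 2 * τ) ≤ extendTop (φ n) τ ∧
        m * extendTop (φ n) τ ≤ coeffMO (expMO P) μ x n (s / 2 * τ) := by
  obtain ⟨m, hm, h⟩ := exists_mem_hullK_modular_expMO_le hPm hr hR hs0 hst
  choose φ hφ hle using fun n => h _ (hx n).nnnorm.aemeasurable (hs n) (ht n)
  refine ⟨m, hm, φ, fun n => ⟨hφ n, fun τ hτ => ?_⟩⟩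
  have hscale : ∀ ω, τ * (s * ‖x n ω‖₊ / 2) = s / 2 * τ * ‖x n ω‖₊ := fun ω => by ring
  simpa only [coeffMO, hscale] using hle n τ hτ

theorem SemiNormalized.exists_subseq_dominates (hx : SemiNormalized (expMO P) μ x)
    (hPm : Measurable P) (hr : 0 < r) (hR : ∀ p ∈ essRange P μ, r ≤ p) :
    ∃ σ : ℕ → ℕ, StrictMono σ ∧ ∃ ψ ∈ hullK (essRange P μ),
      Dominates (modular (fun _ => extendTop ψ) Measure.count)
        (modular (coeffMO (expMO P) μ (x ∘ σ)) Measure.count) ∧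
      Dominates (modular (coeffMO (expMO P) μ (x ∘ σ)) Measure.count)
        (modular (fun _ => extendTop ψ) Measure.count) := by
  have hM : IsMusielak (expMO P) μ := isMusielak_expMO hPm
    (ae_ne_zero_of_le_essRange hPm.aemeasurable hr hR)
  have hmono : ∀ n, Monotone (coeffMO (expMO P) μ x n) := (isMusielak_coeffMO hM .count).monotone
  obtain ⟨s, hs0, hs⟩ := hx.exists_coeffMO_le_one hM
  obtain ⟨t, ht⟩ := hx.exists_one_le_coeffMO
  have hT : ∀ n, 1 ≤ coeffMO (expMO P) μ x n (max s t) := fun n =>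
    (ht n).trans (hmono n (le_max_right _ _))
  obtain ⟨m, hm, φ, hφ⟩ := exists_mem_hullK_coeffMO_le hPm hr hR (fun n => (hx.1 n).1) hs0
    (le_max_left s t) hs hT
  have h0 : (0 : ℝ≥0∞) ∉ essRange P μ := fun h => (ENNReal.coe_pos.2 hr).not_ge (hR 0 h)
  obtain ⟨ψ, hψ, σ, hσ, hdist⟩ := exists_strictMono_forall_dist_lt
    (isCompact_hullK Measure.isClosed_support h0) (fun n => (hφ n).1)
    (ε := fun n => (1 / 2) ^ n) fun n => by positivity
  have hsum := tsum_ofReal_ne_top_of_lt_half_pow hdist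
  have hk : 0 < s / 2 := half_pos hs0
  have hkT : s / 2 ≤ max s t := (NNReal.half_le_self s).trans (le_max_left s t)
  exact ⟨σ, hσ, ψ, hψ,
    dominates_extendTop_of_tsum_dist_ne_top hsum hk fun n τ hτ => ((hφ (σ n)).2 τ hτ).1,
    dominates_of_tsum_dist_extendTop_ne_top hsum (fun n => hmono (σ n)) hk hkT
      (fun n => hT (σ n)) hm fun n τ hτ => ((hφ (σ n)).2 τ hτ).2⟩

end VariableExponent

end VarLeb

open VarLeb in
theorem mainTheorem7_general {𝕜 : Type*} [RCLike 𝕜] {Ω : Type*} [MeasurableSpace Ω]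
    (μ : Measure Ω) (P : Ω → ℝ≥0∞) (hPm : Measurable P)
    (hPmin : 0 < sInf (essRange P μ))
    (x : ℕ → Ω → 𝕜)
    (hdisj : DisjointlySupported μ x)
    (hnorm : SemiNormalized (expMO P) μ x) :
    ∃ σ : ℕ → ℕ, StrictMono σ ∧
      ∃ F ∈ orliczClass (essRange P μ),
        ∃ h : coeffSpace (expMO P) μ (x ∘ σ) = orliczSeqSpace 𝕜 F,
          coeffTopology (expMO P) μ (x ∘ σ) =
            (orliczSeqTopology 𝕜 F).induced (Set.inclusion h.subset) := by
  obtain ⟨r, hr, hrmin⟩ := ENNReal.lt_iff_exists_nnreal_btwn.1 hPmin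
  rw [ENNReal.coe_pos] at hr
  have hR : ∀ p ∈ essRange P μ, r ≤ p := fun p hp => hrmin.le.trans (sInf_le hp)
  obtain ⟨σ, hσ, ψ, hψ, hle, hge⟩ := hnorm.exists_subseq_dominates hPm hr hR
  have hcone : ψ ∈ indexCone r := hullK_subset_indexCone hR hψ
  have hF : IsMusielak (fun _ : ℕ => extendTop ψ) Measure.count :=
    .of_countable (fun _ => monotone_extendTop hcone)
      fun _ => extendTop_map_zero hr hcone
  have hM : IsMusielak (expMO P) μ :=
    isMusielak_expMO hPm (ae_ne_zero_of_le_essRange hPm.aemeasurable hr hR)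
  have hMr : HasLowerIndex r (modular (expMO P) μ) :=
    .modular ((ae_mem_essRange hPm.aemeasurable).mono fun ω hω =>
      hasLowerIndex_potential (hR _ hω))
  have hFr : HasLowerIndex r (modular (fun _ : ℕ => extendTop ψ) Measure.count) :=
    .modular (.of_forall fun _ => hasLowerIndex_extendTop hcone)
  exact ⟨σ, hσ, extendTop ψ, extendTop_mem_orliczClass hr hR hψ,
    coeffTopology_eq_induced_of_dominates hM (hdisj.comp_of_injective hσ.injective)
      (fun n => (hnorm.1 (σ n)).1) hF hr hMr hFr hle hge⟩

theorem mainTheorem7 {𝕜 : Type*} [RCLike 𝕜] {Ω : Type*} [MeasurableSpace Ω]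
    (μ : MeasureTheory.Measure Ω) [MeasureTheory.SigmaFinite μ]
    (P : Ω → ℝ≥0∞) (hPm : Measurable P) (hP : ∀ ω, 0 < P ω)
    (hPmin : 0 < sInf (VarLeb.essRange P μ))
    (x : ℕ → Ω → 𝕜)
    (hdisj : VarLeb.DisjointlySupported μ x)
    (hnorm : VarLeb.SemiNormalized (VarLeb.expMO P) μ x) :
    ∃ σ : ℕ → ℕ, StrictMono σ ∧
      ∃ F ∈ VarLeb.orliczClass (VarLeb.essRange P μ),
        ∃ h : VarLeb.coeffSpace (VarLeb.expMO P) μ (x ∘ σ) = VarLeb.orliczSeqSpace 𝕜 F,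
          VarLeb.coeffTopology (VarLeb.expMO P) μ (x ∘ σ) =
            (VarLeb.orliczSeqTopology 𝕜 F).induced (Set.inclusion h.subset) :=
  mainTheorem7_general μ P hPm hPmin x hdisj hnorm
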